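/- Theorem 1 (Existence). Let $m,n,s_l,s_d$ be nonnegative integers. A prediction game is given by labels $y_1,\dots,y_n\in\{-1,+1\}$, trade-off parameters $\rho_l,\rho_d>0$, penalization functions $\Omega_l:\mathbb R^m\to\mathbb R$ and $\Omega_d:(\mathbb R^m)^n\to\mathbb R$, and loss functions $\ell_l,\ell_d:\mathbb R\times\{-1,+1\}\to\mathbb R$. The costs of the learner and of the data generator, when the learner plays $w\in\mathbb R^m$ and the data generator plays $X=(x_1,\dots,x_n)\in(\mathbb R^m)^n$, are $$c_l(w,X)=\rho_l\,\Omega_l(w)+\sum_{i=1}^n\ell_l(w^\top x_i,y_i),\qquad c_d(w,X)=\rho_d\,\Omega_d(X)+\sum_{i=1}^n\ell_d(w^\top x_i,y_i).$$ A randomized prediction game consists of such a prediction game, nonempty, compact and convex parameter sets $\Theta_l\subseteq\mathbb R^{s_l}$ and $\Theta_d\subseteq\mathbb R^{s_d}$, and probability distributions $p_l(\cdot;\theta_l)$ on $\mathbb R^m$ for $\theta_l\in\Theta_l$ and $p_d(\cdot;\theta_d)$ on $(\mathbb R^m)^n$ for $\theta_d\in\Theta_d$, such that for all $(\theta_l,\theta_d)\in\Theta_l\times\Theta_d$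 the expected costs $$\bar c_l(\theta_l,\theta_d)=\mathbb E[c_l(w,X)],\qquad \bar c_d(\theta_l,\theta_d)=\mathbb E[c_d(w,X)],\qquad w\sim p_l(\cdot;\theta_l),\ X\sim p_d(\cdot;\theta_d)\ \text{independent},$$ are well defined and finite. A Nash equilibrium is a pair $(\theta_l^\star,\theta_d^\star)\in\Theta_l\times\Theta_d$ with $$\theta_l^\star\in\arg\min_{\theta_l\in\Theta_l}\bar c_l(\theta_l,\theta_d^\star),\qquad \theta_d^\star\in\arg\min_{\theta_d\in\Theta_d}\bar c_d(\theta_l^\star,\theta_d).$$ A randomized prediction game has at least one Nash equilibrium if (i) $\bar c_l$ and $\bar c_d$ are continuous on $\Theta_l\times\Theta_d$; (ii) $\bar c_l(\cdot,\theta_d)$ is quasi-convex on $\Theta_l$ for every $\theta_d\in\Theta_d$; (iii) $\bar c_d(\theta_l,\cdot)$ is quasi-convex on $\Theta_d$ for every $\theta_l\in\Theta_l$. -/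

import Mathlib

open MeasureTheory

noncomputable section

/-- A prediction game with `n` labelled training samples and feature space `ℝᵐ`.
A strategy of the learner is a weight vector `w ∈ ℝᵐ`; a strategy of the data generator is a tuple
`X = (X 1, …, X n)` of points of `ℝᵐ`. The two labels `-1`, `+1` are the units of `ℤ`. -/
structure PredictionGame (m n : ℕ) where
  /-- the labels of the samples -/
  y : Fin n → ℤˣ
  /-- trade-off parameter of the learner -/
  ρl : ℝ
  /-- trade-off parameter of the data generator -/
  ρd : ℝ
  ρl_pos : 0 < ρl
  ρd_pos : 0 < ρd
  /-- strategy penalization of the learner -/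
  Ωl : EuclideanSpace ℝ (Fin m) → ℝ
  /-- strategy penalization of the data generator -/
  Ωd : (Fin n → EuclideanSpace ℝ (Fin m)) → ℝ
  /-- loss of the learner, as a function of the decision value and the true label -/
  lossl : ℝ → ℤˣ → ℝ
  /-- loss of the data generator, as a function of the decision value and the true label -/
  lossd : ℝ → ℤˣ → ℝ

namespace PredictionGame

variable {m n : ℕ} (P : PredictionGame m n)

/-- The cost of the learner: `ρ_l Ω_l(w) + ∑ᵢ ℓ_l(wᵀ xᵢ, yᵢ)`. -/
def costl (w : EuclideanSpace ℝ (Fin m)) (X : Fin n → EuclideanSpace ℝ (Fin m)) : ℝ :=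
  P.ρl * P.Ωl w + ∑ i, P.lossl (inner ℝ w (X i)) (P.y i)

/-- The cost of the data generator: `ρ_d Ω_d(X) + ∑ᵢ ℓ_d(wᵀ xᵢ, yᵢ)`. -/
def costd (w : EuclideanSpace ℝ (Fin m)) (X : Fin n → EuclideanSpace ℝ (Fin m)) : ℝ :=
  P.ρd * P.Ωd X + ∑ i, P.lossd (inner ℝ w (X i)) (P.y i)

end PredictionGame

/-- A randomized prediction game: an underlying prediction game, nonempty compact convex parameter
sets `Θ_l ⊆ ℝ^{s_l}` and `Θ_d ⊆ ℝ^{s_d}`, and parametrized probability distributions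
`p_l(·; θ_l)`, `p_d(·; θ_d)` over the strategies of the prediction game, such that the expectations
of both costs are finite. The values of `pl`, `pd` off the parameter sets are irrelevant. -/
structure RandomizedPredictionGame (m n sl sd : ℕ) extends PredictionGame m n where
  /-- the parameter set of the learner -/
  Θl : Set (EuclideanSpace ℝ (Fin sl))
  /-- the parameter set of the data generator -/
  Θd : Set (EuclideanSpace ℝ (Fin sd))
  Θl_nonempty : Θl.Nonempty
  Θd_nonempty : Θd.Nonempty
  Θl_compact : IsCompact Θl
  Θd_compact : IsCompact Θd
  Θl_convex : Convex ℝ Θl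
  Θd_convex : Convex ℝ Θd
  /-- the parametrized distribution of the learner's strategy -/
  pl : EuclideanSpace ℝ (Fin sl) → Measure (EuclideanSpace ℝ (Fin m))
  /-- the parametrized distribution of the data generator's strategy -/
  pd : EuclideanSpace ℝ (Fin sd) → Measure (Fin n → EuclideanSpace ℝ (Fin m))
  pl_prob : ∀ θl ∈ Θl, IsProbabilityMeasure (pl θl)
  pd_prob : ∀ θd ∈ Θd, IsProbabilityMeasure (pd θd)
  costl_integrable : ∀ θl ∈ Θl, ∀ θd ∈ Θd,
    Integrable (fun z => toPredictionGame.costl z.1 z.2) ((pl θl).prod (pd θd))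
  costd_integrable : ∀ θl ∈ Θl, ∀ θd ∈ Θd,
    Integrable (fun z => toPredictionGame.costd z.1 z.2) ((pl θl).prod (pd θd))

namespace RandomizedPredictionGame

variable {m n sl sd : ℕ} (G : RandomizedPredictionGame m n sl sd)

/-- The expected cost of the learner, for independent `w ∼ p_l(·; θ_l)` and `X ∼ p_d(·; θ_d)`. -/
def expCostl (θl : EuclideanSpace ℝ (Fin sl)) (θd : EuclideanSpace ℝ (Fin sd)) : ℝ :=
  ∫ z, G.costl z.1 z.2 ∂((G.pl θl).prod (G.pd θd))

/-- The expected cost of the data generator, for independent `w ∼ p_l(·; θ_l)` and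
`X ∼ p_d(·; θ_d)`. -/
def expCostd (θl : EuclideanSpace ℝ (Fin sl)) (θd : EuclideanSpace ℝ (Fin sd)) : ℝ :=
  ∫ z, G.costd z.1 z.2 ∂((G.pl θl).prod (G.pd θd))

/-- `(θl, θd)` is a Nash equilibrium: a strategy profile in which each player's parameter minimizes
that player's expected cost over the player's own parameter set, the other parameter being fixed. -/
def IsNashEquilibrium (θl : EuclideanSpace ℝ (Fin sl)) (θd : EuclideanSpace ℝ (Fin sd)) : Prop :=
  θl ∈ G.Θl ∧ θd ∈ G.Θd ∧
    (∀ θl' ∈ G.Θl, G.expCostl θl θd ≤ G.expCostl θl' θd) ∧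
    (∀ θd' ∈ G.Θd, G.expCostd θl θd ≤ G.expCostd θl θd')

end RandomizedPredictionGame

end

/-! The result is Nash's theorem for two players with continuous quasi-convex costs,
`exists_nash_of_quasiconvexOn`. By compactness it is enough to resist finitely many deviations, `A`
for one player and `B` for the other. A point `p` of the simplex on `A × B` gives a profile `(X p, Y
p)` of convex combinations. The closed set `G (a, b)` collects the `p` for which `a` and `b` are
cheapest within `A` and `B` against that profile; finite minima exist, so these sets cover the
simplex. If `p` lies in `G i` for every `i` in its support, then `X p` averages points that are
cheapest against `Y p`, and convexity of sublevel sets makes `X p` at least as cheap as each `a ∈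
A`; likewise for `Y p`.

Such a `p` comes from `exists_mem_stdSimplex_of_closed_cover`, a covering theorem of KKM type
without boundary conditions. It is the limit of a statement on lattice points,
`exists_lattice_point_near_colors`, which follows from Scarf's lemma,
`IsSlackRanking.exists_colorful`. The latter is a parity argument and needs no triangulation. -/

/-! ### Scarf's lemma: dominant sets and parity. -/

/-- A finite set `S` is dominant for the rankings `r i` if no element lies, in every ranking,
strictly above the lowest element of `S`. -/
def IsDominant {I X : Type*} (r : I → X → ℕ) (S : Finset X) : Prop :=
  ∀ y, ∃ i, ∀ x ∈ S, r i y ≤ r i x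

theorem IsDominant.mono {I X : Type*} {r : I → X → ℕ} {S R : Finset X} (h : IsDominant r R)
    (hSR : S ⊆ R) : IsDominant r S := fun y =>
  (h y).imp fun _ hi x hx => hi x (hSR hx)

/-- Injective rankings `r i` of a finite set, together with slack elements: `s i` is the lowest
element of the ranking `r i`, while in all other rankings it is above all non-slack elements. -/
structure IsSlackRanking {I X : Type*} (r : I → X → ℕ) (s : I → X) : Prop where
  inj : ∀ i, Function.Injective (r i)
  slack_inj : Function.Injective s
  slack_le : ∀ i x, r i (s i) ≤ r i x
  lt_slack : ∀ i j x, i ≠ j → x ∉ Set.range s → r i x < r i (s j)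

/-- Removing one element from a set that misses a colour leaves all colours but `i₀` for exactly
zero or two choices of that element. -/
theorem even_card_subsets_image_eq_erase {I X : Type*} [Fintype I] [DecidableEq I] [DecidableEq X]
    (c : X → I) (i₀ : I) (R : Finset X) (hR : R.card = Fintype.card I)
    (hc : R.image c ≠ Finset.univ) (D : Finset (Finset X))
    (hD : ∀ S, S ∈ D ↔ S ⊆ R ∧ S.card + 1 = Fintype.card I ∧ S.image c = Finset.univ.erase i₀) :
    Even D.card := by
  classical
  rcases D.eq_empty_or_nonempty with h | ⟨S, hS⟩
  · simp [h]
  have herase : ∀ S ∈ D, ∃ x ∈ R, S = R.erase x := by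
    intro S hS
    obtain ⟨h1, h2, -⟩ := (hD S).1 hS
    have h3 : (R \ S).card = 1 := by
      rw [Finset.card_sdiff_of_subset h1]; omega
    obtain ⟨x, hx⟩ := Finset.card_eq_one.1 h3
    have hx' : x ∈ R \ S := by simp [hx]
    refine ⟨x, (Finset.mem_sdiff.1 hx').1, ?_⟩
    rw [← Finset.sdiff_singleton_eq_erase, ← hx, Finset.sdiff_sdiff_eq_self h1]
  obtain ⟨x, hxR, rfl⟩ := herase S hS
  obtain ⟨-, hcard, himg⟩ := (hD _).1 hS
  have hinj : Set.InjOn c (R.erase x : Finset X) := by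
    rw [← Finset.card_image_iff, himg, Finset.card_erase_of_mem (Finset.mem_univ _),
      Finset.card_univ]
    omega
  have hcx : c x ≠ i₀ := by
    intro h
    apply hc
    rw [← Finset.insert_erase hxR, Finset.image_insert, himg, h,
      Finset.insert_erase (Finset.mem_univ _)]
  have hmem : c x ∈ (R.erase x).image c := by simp [himg, hcx]
  -- The colour of `x` occurs a second time in `R`, at `x'`. As `c` is injective on `R.erase x`,
  -- only `x` and `x'` can be removed without losing a colour.
  obtain ⟨x', hx', hcx'⟩ := Finset.mem_image.1 hmem
  have hx'R := Finset.mem_of_mem_erase hx'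
  have hne : x' ≠ x := Finset.ne_of_mem_erase hx'
  have hD2 : D = {R.erase x, R.erase x'} := by
    ext S
    constructor
    · intro hS'
      obtain ⟨z, hz, rfl⟩ := herase S hS'
      obtain ⟨-, -, himg'⟩ := (hD _).1 hS'
      by_contra hcon
      simp only [Finset.mem_insert, Finset.mem_singleton, not_or] at hcon
      have hzx : z ≠ x := fun h => hcon.1 (by rw [h])
      have hzx' : z ≠ x' := fun h => hcon.2 (by rw [h])
      have hz0 : z ∈ R.erase x := Finset.mem_erase.2 ⟨hzx, hz⟩
      have : c z ∈ (R.erase z).image c := by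
        rw [himg', ← himg]; exact Finset.mem_image_of_mem _ hz0
      obtain ⟨w, hw, hcw⟩ := Finset.mem_image.1 this
      by_cases hwx : w = x
      · subst hwx
        exact hzx' (hinj (by exact_mod_cast hz0) (by exact_mod_cast hx') (by rw [← hcw, hcx']))
      · have hw0 : w ∈ R.erase x := Finset.mem_erase.2 ⟨hwx, Finset.mem_of_mem_erase hw⟩
        exact Finset.ne_of_mem_erase hw
          (hinj (by exact_mod_cast hw0) (by exact_mod_cast hz0) hcw)
    · intro hS'
      rcases Finset.mem_insert.1 hS' with rfl | hS'
      · exact hS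
      · rw [Finset.mem_singleton] at hS'
        subst hS'
        refine (hD _).2 ⟨Finset.erase_subset _ _, ?_, ?_⟩
        · rw [← hcard, Finset.card_erase_of_mem hx'R, Finset.card_erase_of_mem hxR]
        · rw [← himg]
          ext k
          simp only [Finset.mem_image, Finset.mem_erase]
          constructor
          · rintro ⟨w, ⟨hw, hwR⟩, rfl⟩
            by_cases h : w = x
            · exact ⟨x', ⟨hne, hx'R⟩, by rw [h, hcx']⟩
            · exact ⟨w, ⟨h, hwR⟩, rfl⟩
          · rintro ⟨w, ⟨hw, hwR⟩, rfl⟩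
            by_cases h : w = x'
            · exact ⟨x, ⟨hne.symm, hxR⟩, by rw [h, hcx']⟩
            · exact ⟨w, ⟨h, hwR⟩, rfl⟩
  have : R.erase x ≠ R.erase x' := by
    intro h
    have : x' ∈ R.erase x' := h ▸ hx'
    simp at this
  rw [hD2, Finset.card_pair this]
  exact even_two

theorem superset_card_succ {X : Type*} [DecidableEq X] {S R : Finset X} {n : ℕ}
    (hS : S.card + 1 = n) (hR : R.card = n) (h : S ⊆ R) : ∃ x ∉ S, R = insert x S := by
  have h3 : (R \ S).card = 1 := by
    rw [Finset.card_sdiff_of_subset h]; omega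
  obtain ⟨x, hx⟩ := Finset.card_eq_one.1 h3
  have hx' : x ∈ R \ S := by simp [hx]
  refine ⟨x, (Finset.mem_sdiff.1 hx').2, ?_⟩
  rw [← Finset.sdiff_union_of_subset h, hx]; rfl

/-- The set of all slack elements but `s i₀` has exactly one dominant extension by one element. -/
theorem card_rooms_slack_eq_one {I X : Type*} [Fintype I] [DecidableEq I] [Fintype X]
    [DecidableEq X] {r : I → X → ℕ} {s : I → X} (h : IsSlackRanking r s)
    (hT : ∃ t, t ∉ Set.range s) (i₀ : I) (D : Finset (Finset X))
    (hD : ∀ R, R ∈ D ↔ (Finset.univ.erase i₀).image s ⊆ R ∧ R.card = Fintype.card I ∧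
      IsDominant r R) : D.card = 1 := by
  obtain ⟨t, ht⟩ := hT
  set S := (Finset.univ.erase i₀).image s with hSdef
  have hScard : S.card + 1 = Fintype.card I := by
    rw [hSdef, Finset.card_image_of_injective _ h.slack_inj,
      Finset.card_erase_of_mem (Finset.mem_univ _), Finset.card_univ]
    have := Fintype.card_pos_iff.2 ⟨i₀⟩
    omega
  have hs : ∀ j, j ≠ i₀ → s j ∈ S := fun j hj => by
    simp only [hSdef, Finset.mem_image, Finset.mem_erase]
    exact ⟨j, ⟨hj, Finset.mem_univ _⟩, rfl⟩
  have hSmem : ∀ x ∈ S, ∃ j, j ≠ i₀ ∧ x = s j := by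
    intro x hx
    simp only [hSdef, Finset.mem_image, Finset.mem_erase] at hx
    obtain ⟨j, ⟨hj, -⟩, rfl⟩ := hx
    exact ⟨j, hj, rfl⟩
  have htS : t ∉ S := fun hx => by
    obtain ⟨j, -, rfl⟩ := hSmem t hx
    exact ht ⟨j, rfl⟩
  -- A ranking `l ≠ i₀` has its lowest element `s l` in `S`, so it bounds no element outside `S`.
  -- Dominance is thus decided by `r i₀`, and the added element must be the highest one outside `S`.
  obtain ⟨x, hx, hmax⟩ := Finset.exists_max_image Sᶜ (r i₀) ⟨t, by simpa using htS⟩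
  have hxS : x ∉ S := by simpa using hx
  have hle : ∀ l y, r l y ≤ r l (s l) → y = s l := fun l y hy =>
    h.inj l (le_antisymm hy (h.slack_le l y))
  have hdom : IsDominant r (insert x S) := by
    intro y
    by_cases hy : y ∈ S
    · obtain ⟨l, -, rfl⟩ := hSmem y hy
      exact ⟨l, fun z _ => h.slack_le l z⟩
    · refine ⟨i₀, fun z hz => ?_⟩
      rcases Finset.mem_insert.1 hz with rfl | hz
      · exact hmax y (by simpa using hy)
      · obtain ⟨j, hj, rfl⟩ := hSmem z hz
        by_cases hys : y ∈ Set.range s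
        · obtain ⟨l, rfl⟩ := hys
          by_cases hl : l = i₀
          · subst hl; exact h.slack_le _ _
          · exact absurd (hs l hl) hy
        · exact (h.lt_slack _ _ _ hj.symm hys).le
  rw [Finset.card_eq_one]
  refine ⟨insert x S, ?_⟩
  ext R
  rw [hD, Finset.mem_singleton]
  constructor
  · rintro ⟨hSR, hcard, hR⟩
    obtain ⟨x', hx', rfl⟩ := superset_card_succ hScard hcard hSR
    have hx'0 : x' ≠ s i₀ := by
      rintro rfl
      obtain ⟨l, hl⟩ := hR t
      refine ht ⟨l, (hle l t (hl (s l) ?_)).symm⟩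
      by_cases hl0 : l = i₀
      · subst hl0; exact Finset.mem_insert_self _ _
      · exact Finset.mem_insert_of_mem (hs l hl0)
    obtain ⟨l, hl⟩ := hR x
    have hl0 : l = i₀ := by
      by_contra hl0
      exact hxS (hle l x (hl _ (Finset.mem_insert_of_mem (hs l hl0))) ▸ hs l hl0)
    subst hl0
    rw [h.inj l (le_antisymm (hl x' (Finset.mem_insert_self _ _)) (hmax x' (by simpa using hx')))]
  · rintro rfl
    exact ⟨Finset.subset_insert _ _, by rw [Finset.card_insert_of_notMem hxS, hScard], hdom⟩

/-- A dominant set with one element less than there are rankings, other than the sets of all slack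
elements but one, has exactly two dominant extensions by one element. -/
theorem card_rooms_eq_two {I X : Type*} [Fintype I] [DecidableEq I] [Fintype X]
    [DecidableEq X] {r : I → X → ℕ} {s : I → X} (h : IsSlackRanking r s)
    (S : Finset X) (hS : IsDominant r S) (hcard : S.card + 1 = Fintype.card I)
    (hne : ∀ i, S ≠ (Finset.univ.erase i).image s) (D : Finset (Finset X))
    (hD : ∀ R, R ∈ D ↔ S ⊆ R ∧ R.card = Fintype.card I ∧ IsDominant r R) : D.card = 2 := by
  have hSne : S.Nonempty := by
    rw [Finset.nonempty_iff_ne_empty]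
    rintro rfl
    obtain ⟨i, hi⟩ := Finset.card_eq_one.1 (show (Finset.univ : Finset I).card = 1 by
      rw [Finset.card_univ, ← hcard]; simp)
    exact hne i (by simp [hi])
  -- Dominance makes `m : I → S` surjective, and `S` has one element less than `I`. Hence `m`
  -- identifies exactly one pair `i ≠ j`. An added element becomes the new minimum of one ranking
  -- `k`, and every old minimum must survive elsewhere, so `k` is `i` or `j`.
  choose m hmS hm using fun i => Finset.exists_min_image S (r i) hSne
  have hsurj : ∀ x ∈ S, ∃ i, m i = x := fun x hx => by
    obtain ⟨i, hi⟩ := hS x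
    exact ⟨i, h.inj i (le_antisymm (hm i x hx) (hi _ (hmS i)))⟩
  have hinj : ∀ k l, k ≠ l → m k = m l → Set.InjOn m (Finset.univ.erase k : Finset I) := by
    intro k l hkl hkl'
    have : (Finset.univ.erase k).image m = S := by
      ext x
      constructor
      · intro hx
        obtain ⟨j, -, rfl⟩ := Finset.mem_image.1 hx
        exact hmS j
      · intro hx
        obtain ⟨j, rfl⟩ := hsurj x hx
        by_cases hj : j = k
        · exact Finset.mem_image.2 ⟨l, by simpa using hkl.symm, by rw [hj, hkl']⟩
        · exact Finset.mem_image.2 ⟨j, by simpa using hj, rfl⟩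
    rw [← Finset.card_image_iff, this, Finset.card_erase_of_mem (Finset.mem_univ _),
      Finset.card_univ]
    omega
  obtain ⟨i, -, j, -, hij, hmij⟩ := Finset.exists_ne_map_eq_of_card_lt_of_maps_to
    (s := Finset.univ) (t := S) (f := m) (by rw [Finset.card_univ]; omega) (fun k _ => hmS k)
  have hpair : ∀ k l, k ≠ l → m k = m l → k = i ∨ k = j := by
    intro k l hkl hkl'
    by_contra! hcon
    have h1 : l = i := by
      by_contra hli
      exact hkl (hinj i j hij hmij (by simpa using hcon.1) (by simpa using hli) hkl')
    have h2 : l = j := by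
      by_contra hlj
      exact hkl (hinj j i hij.symm hmij.symm (by simpa using hcon.2) (by simpa using hlj) hkl')
    exact hij (h1.symm.trans h2)
  -- This makes `s k` a candidate for the maximum `e k` below. It could fail only if `S` consisted
  -- of all slack elements but `s l`, which `hne` excludes.
  have hslack : ∀ k l, l ≠ k → r l (m l) < r l (s k) := by
    intro k l hlk
    by_cases hml : m l ∈ Set.range s
    · obtain ⟨l', hl'⟩ := hml
      by_cases hll : l' = l
      · rw [← hl', hll]
        refine lt_of_le_of_ne (h.slack_le l _) fun he => hlk (h.slack_inj (h.inj l he))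
      · exfalso
        have hsub : S ⊆ (Finset.univ.erase l).image s := by
          intro x hx
          have hxm := hm l x hx
          rw [← hl'] at hxm
          by_cases hxs : x ∈ Set.range s
          · obtain ⟨a, rfl⟩ := hxs
            refine Finset.mem_image_of_mem _ ?_
            simp only [Finset.mem_erase, Finset.mem_univ, and_true]
            rintro rfl
            exact hll (h.slack_inj (h.inj a (le_antisymm hxm (h.slack_le _ _))))
          · exact absurd (h.lt_slack l l' x (Ne.symm hll) hxs) (not_lt.2 hxm)
        refine hne l (Finset.eq_of_subset_of_card_le hsub ?_)
        rw [Finset.card_image_of_injective _ h.slack_inj,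
          Finset.card_erase_of_mem (Finset.mem_univ _), Finset.card_univ]
        omega
    · exact h.lt_slack l k _ hlk hml
  have hex : ∀ k, ∃ x, (∀ l, l ≠ k → r l (m l) < r l x) ∧
      ∀ y, (∀ l, l ≠ k → r l (m l) < r l y) → r k y ≤ r k x := by
    intro k
    obtain ⟨x, hx, hmax⟩ := Finset.exists_max_image
      (Finset.univ.filter fun x => ∀ l, l ≠ k → r l (m l) < r l x) (r k)
      ⟨s k, by simpa using fun l hl => hslack k l hl⟩
    exact ⟨x, (Finset.mem_filter.1 hx).2, fun y hy =>
      hmax y (Finset.mem_filter.2 ⟨Finset.mem_univ _, hy⟩)⟩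
  choose e he hemax using hex
  have hroom : ∀ k k', k ≠ k' → m k = m k' → e k ∉ S ∧ IsDominant r (insert (e k) S) := by
    intro k k' hkk hmk
    refine ⟨fun hmem => ?_, fun y => ?_⟩
    · obtain ⟨l, hl⟩ := hsurj _ hmem
      by_cases hlk : l = k
      · have := he k k' hkk.symm
        rw [← hmk, ← hlk, hl, hlk] at this
        exact lt_irrefl _ this
      · have := he k l hlk
        rw [hl] at this
        exact lt_irrefl _ this
    · by_cases hy : ∀ l, l ≠ k → r l (m l) < r l y
      · obtain ⟨l, hl⟩ := hS y
        have hlk : l = k := by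
          by_contra hlk
          exact absurd (hl _ (hmS l)) (not_le.2 (hy l hlk))
        subst hlk
        exact ⟨l, fun z hz => (Finset.mem_insert.1 hz).elim (fun hz => hz ▸ hemax l y hy) (hl z)⟩
      · push Not at hy
        obtain ⟨l, hlk, hl⟩ := hy
        exact ⟨l, fun z hz => (Finset.mem_insert.1 hz).elim
          (fun hz => hz ▸ (hl.trans (he k l hlk).le)) (fun hz => hl.trans (hm l z hz))⟩
  have heij : e i ≠ e j := by
    intro heq
    obtain ⟨l, hl⟩ := hS (e i)
    have hli : l = i := by
      by_contra hli
      exact absurd (hl _ (hmS l)) (not_le.2 (he i l hli))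
    subst hli
    exact absurd (hl _ (hmS l)) (not_le.2 (heq ▸ he j l hij))
  have huniq : ∀ x, x ∉ S → IsDominant r (insert x S) → x = e i ∨ x = e j := by
    intro x hx hdom
    obtain ⟨k, hk⟩ := hdom x
    have hkx : r k x < r k (m k) :=
      lt_of_le_of_ne (hk _ (Finset.mem_insert_of_mem (hmS k)))
        fun he => hx (h.inj k he ▸ hmS k)
    have hidx : ∀ z ∈ S, ∃ l, l ≠ k ∧ m l = z ∧ r l z < r l x := by
      intro z hz
      obtain ⟨l, hl⟩ := hdom z
      have hzl : m l = z := h.inj l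
        (le_antisymm (hm l z hz) (hl _ (Finset.mem_insert_of_mem (hmS l))))
      have hzx := hl x (Finset.mem_insert_self _ _)
      refine ⟨l, ?_, hzl, lt_of_le_of_ne hzx fun he => hx (h.inj l he ▸ hz)⟩
      rintro rfl
      rw [← hzl] at hzx
      exact absurd hkx (not_lt.2 hzx)
    obtain ⟨k', hk', hmk', -⟩ := hidx _ (hmS k)
    have hxe : x = e k := by
      have hlt : ∀ l, l ≠ k → r l (m l) < r l x := by
        intro l hl
        obtain ⟨l', hl', hml', hlt⟩ := hidx _ (hmS l)
        have : l' = l := hinj k k' hk'.symm hmk'.symm (by simpa using hl') (by simpa using hl) hml'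
        exact this ▸ hlt
      refine h.inj k (le_antisymm (hemax k x hlt) ?_)
      obtain ⟨l, hl⟩ := hdom (e k)
      have hlk : l = k := by
        by_contra hlk
        exact absurd (hl _ (Finset.mem_insert_of_mem (hmS l))) (not_le.2 (he k l hlk))
      subst hlk
      exact hl x (Finset.mem_insert_self _ _)
    rcases hpair k k' hk'.symm hmk'.symm with rfl | rfl
    · exact Or.inl hxe
    · exact Or.inr hxe
  obtain ⟨hi1, hi2⟩ := hroom i j hij hmij
  obtain ⟨hj1, hj2⟩ := hroom j i hij.symm hmij.symm
  have hD2 : D = {insert (e i) S, insert (e j) S} := by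
    ext R
    rw [hD, Finset.mem_insert, Finset.mem_singleton]
    constructor
    · rintro ⟨hSR, hc, hR⟩
      obtain ⟨x, hx, rfl⟩ := superset_card_succ hcard hc hSR
      rcases huniq x hx hR with rfl | rfl
      · exact Or.inl rfl
      · exact Or.inr rfl
    · rintro (rfl | rfl)
      · exact ⟨Finset.subset_insert _ _, by rw [Finset.card_insert_of_notMem hi1, hcard], hi2⟩
      · exact ⟨Finset.subset_insert _ _, by rw [Finset.card_insert_of_notMem hj1, hcard], hj2⟩
  rw [hD2, Finset.card_pair]
  intro heq
  have : e i ∈ insert (e j) S := heq ▸ Finset.mem_insert_self _ _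
  rcases Finset.mem_insert.1 this with h' | h'
  · exact heij h'
  · exact hi1 h'

/-- **Scarf's lemma**: for every colouring in which the slack element `s i` has colour `i`,
there is a dominant set in which every colour occurs exactly once. -/
theorem IsSlackRanking.exists_colorful {I X : Type*} [Fintype I] [Nonempty I] [Finite X]
    {r : I → X → ℕ} {s : I → X} (h : IsSlackRanking r s)
    (hT : ∃ t, t ∉ Set.range s) (c : X → I) (hc : ∀ i, c (s i) = i) :
    ∃ e : I → X, (∀ i, c (e i) = i) ∧ ∀ y, ∃ i, ∀ j, r i y ≤ r i (e j) := by
  classical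
  have := Fintype.ofFinite X
  obtain ⟨i₀⟩ := ‹Nonempty I›
  by_contra hcon
  have hcol : ∀ R : Finset X, IsDominant r R → R.image c ≠ Finset.univ := by
    intro R hR himg
    have : ∀ i, ∃ x ∈ R, c x = i := fun i => Finset.mem_image.1 (himg ▸ Finset.mem_univ i)
    choose e heR he using this
    exact hcon ⟨e, he, fun y => (hR y).imp fun i hi j => hi _ (heR j)⟩
  -- Count pairs of a door inside a room. Without a colourful room, each room has zero or two doors;
  -- each door lies in two rooms, except `S₀`, which lies in one. The total would be both even and
  -- odd.
  let rooms : Finset (Finset X) :=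
    Finset.univ.filter fun R => R.card = Fintype.card I ∧ IsDominant r R
  let doors : Finset (Finset X) := Finset.univ.filter fun S =>
    IsDominant r S ∧ S.card + 1 = Fintype.card I ∧ S.image c = Finset.univ.erase i₀
  set S₀ : Finset X := (Finset.univ.erase i₀).image s with hS₀
  have hpos := Fintype.card_pos_iff.2 ⟨i₀⟩
  have himg₀ : ∀ i, ((Finset.univ.erase i).image s).image c = Finset.univ.erase i := fun i => by
    rw [Finset.image_image, show c ∘ s = id from funext hc, Finset.image_id]
  have hS₀mem : S₀ ∈ doors := by
    refine Finset.mem_filter.2 ⟨Finset.mem_univ _, ?_, ?_, himg₀ i₀⟩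
    · have hone := card_rooms_slack_eq_one h hT i₀ (Finset.univ.filter fun R =>
        (Finset.univ.erase i₀).image s ⊆ R ∧ R.card = Fintype.card I ∧ IsDominant r R) (by simp)
      obtain ⟨R, hR⟩ := Finset.card_pos.1 (by rw [hone]; exact one_pos)
      obtain ⟨-, h1, -, h2⟩ := Finset.mem_filter.1 hR
      exact h2.mono h1
    · rw [hS₀, Finset.card_image_of_injective _ h.slack_inj,
        Finset.card_erase_of_mem (Finset.mem_univ _), Finset.card_univ]
      omega
  have hcount := Finset.sum_card_bipartiteAbove_eq_sum_card_bipartiteBelow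
    (s := doors) (t := rooms) (fun S R => S ⊆ R)
  have heven : Even (∑ R ∈ rooms, (Finset.bipartiteBelow (fun S R => S ⊆ R) doors R).card) := by
    refine Finset.even_sum _ fun R hR => ?_
    obtain ⟨-, hR1, hR2⟩ := Finset.mem_filter.1 hR
    refine even_card_subsets_image_eq_erase c i₀ R hR1 (hcol R hR2) _ fun S => ?_
    simp only [Finset.bipartiteBelow, doors, Finset.mem_filter, Finset.mem_univ, true_and]
    exact ⟨fun hx => ⟨hx.2, hx.1.2⟩, fun hx => ⟨⟨hR2.mono hx.1, hx.2⟩, hx.1⟩⟩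
  rw [← hcount, ← Finset.add_sum_erase _ _ hS₀mem,
    card_rooms_slack_eq_one h hT i₀ _ (fun R => by
      simp only [Finset.bipartiteAbove, rooms, Finset.mem_filter, Finset.mem_univ, true_and]
      exact and_comm)] at heven
  have heven' : Even (∑ S ∈ doors.erase S₀,
      (Finset.bipartiteAbove (fun S R => S ⊆ R) rooms S).card) := by
    refine Finset.even_sum _ fun S hS => ?_
    obtain ⟨hne, hS⟩ := Finset.mem_erase.1 hS
    obtain ⟨-, hS1, hS2, hS3⟩ := Finset.mem_filter.1 hS
    rw [card_rooms_eq_two h S hS1 hS2 ?_ _ (fun R => by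
      simp only [Finset.bipartiteAbove, rooms, Finset.mem_filter, Finset.mem_univ, true_and]
      exact and_comm)]
    · exact even_two
    · rintro i rfl
      rw [himg₀] at hS3
      have : i = i₀ := by
        by_contra hi
        have hmem : i₀ ∈ Finset.univ.erase i := by simpa using Ne.symm hi
        rw [hS3] at hmem
        simp at hmem
      exact hne (by rw [this])
  exact absurd heven (by rw [Nat.not_even_iff_odd]; exact (odd_one).add_even heven')

/-! ### From Scarf's lemma to lattice points of a simplex. -/

/-- Among the colours of the lattice points of the simplex `∑ xᵢ = M`, there is a lattice point `p`
that is close to a point of colour `i` for each coordinate `i` that is not small. -/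
theorem exists_lattice_point_near_colors {I : Type*} [Fintype I] [Nonempty I] (M : ℕ)
    (c : (I → ℕ) → I) : ∃ p : I → ℕ, ∑ k, p k = M ∧
      ∀ i, p i ≤ Fintype.card I ∨ ∃ x : I → ℕ, ∑ k, x k = M ∧ c x = i ∧
        ∀ k, p k ≤ x k + Fintype.card I ∧ x k ≤ p k + Fintype.card I := by
  classical
  let T := {x : I → ℕ // x ∈ Finset.piAntidiag Finset.univ M}
  let : Fintype T := Finset.fintypeCoeSort _
  have hTsum : ∀ x : T, ∑ k, x.1 k = M := fun x => (Finset.mem_piAntidiag.1 x.2).1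
  have hTmk : ∀ x : I → ℕ, ∑ k, x k = M → x ∈ Finset.piAntidiag Finset.univ M := fun x hx =>
    Finset.mem_piAntidiag.2 ⟨hx, by simp⟩
  let X := I ⊕ T
  let : Fintype X := inferInstanceAs (Fintype (I ⊕ T))
  -- Lattice points take values from `1` to `M + 1`, so `0` lies below and `M + 2` above all of
  -- them. The rankings `r` break ties by `code`, which is smaller than the factor `Fintype.card X`.
  let q : X → I → ℕ := Sum.elim (fun j i => if i = j then 0 else M + 2) (fun x i => x.1 i + 1)
  let code := Fintype.equivFin X
  let r : I → X → ℕ := fun i x => q x i * Fintype.card X + code x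
  have hlt : ∀ i x y, q x i < q y i → r i x < r i y := by
    intro i x y hxy
    have h1 := (code x).2
    have h2 : (q x i + 1) * Fintype.card X ≤ q y i * Fintype.card X := Nat.mul_le_mul_right _ hxy
    simp only [r]
    rw [add_mul] at h2
    omega
  have hle : ∀ i x y, r i x ≤ r i y → q x i ≤ q y i := fun i x y hxy =>
    not_lt.1 fun h => absurd (hlt i y x h) (not_lt.2 hxy)
  have hTle : ∀ (x : T) i, x.1 i ≤ M := fun x i =>
    (Finset.single_le_sum (fun _ _ => Nat.zero_le _) (Finset.mem_univ i)).trans_eq (hTsum x)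
  have hrank : IsSlackRanking r (Sum.inl : I → X) := by
    refine ⟨fun i x y hxy => ?_, Sum.inl_injective, fun i x => ?_, fun i j x hij hx => ?_⟩
    · have hq : q x i = q y i := le_antisymm (hle i x y hxy.le) (hle i y x hxy.ge)
      simp only [r, hq, add_right_inj] at hxy
      exact code.injective (Fin.ext hxy)
    · by_cases hx : x = Sum.inl i
      · rw [hx]
      · refine (hlt i _ _ ?_).le
        rcases x with j | x
        · have : i ≠ j := fun h => hx (by rw [h])
          simp [q, this]
        · simp [q]
    · rcases x with k | x
      · exact absurd ⟨k, rfl⟩ hx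
      · refine hlt i _ _ ?_
        have := hTle x i
        simp only [q, Sum.elim_inl, Sum.elim_inr, if_neg hij]
        omega
  obtain ⟨i₁⟩ := ‹Nonempty I›
  have : Nonempty I := ⟨i₁⟩
  let t₀ : T := ⟨Pi.single i₁ M, hTmk _ (by simp)⟩
  obtain ⟨e, hce, hdom⟩ := hrank.exists_colorful ⟨Sum.inr t₀, by simp⟩
    (Sum.elim id fun x => c x.1) (fun i => rfl)
  let C : Finset I := Finset.univ.filter fun i => ∃ x : T, e i = Sum.inr x
  let Z : I → T := fun i => Sum.elim (fun _ => t₀) id (e i)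
  have hZ : ∀ i ∈ C, e i = Sum.inr (Z i) := by
    intro i hi
    obtain ⟨x, hx⟩ := (Finset.mem_filter.1 hi).2
    simp [Z, hx]
  have hnC : ∀ i, i ∉ C → e i = Sum.inl i := by
    intro i hi
    rcases he : e i with j | x
    · have := hce i
      rw [he] at this
      exact congrArg _ this
    · exact absurd (Finset.mem_filter.2 ⟨Finset.mem_univ _, x, he⟩) hi
  have hdomT : ∀ y : I → ℕ, ∑ k, y k = M → ∃ i ∈ C, ∀ j ∈ C, y i ≤ (Z j).1 i := by
    intro y hy
    obtain ⟨i, hi⟩ := hdom (Sum.inr ⟨y, hTmk y hy⟩)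
    have hiC : i ∈ C := by
      by_contra hiC
      have := hle _ _ _ (hi i)
      rw [hnC i hiC] at this
      simp [q] at this
    refine ⟨i, hiC, fun j hj => ?_⟩
    have := hle _ _ _ (hi j)
    rw [hZ j hj] at this
    simpa [q] using this
  obtain ⟨j₀, hj₀, -⟩ := hdomT _ (hTsum t₀)
  choose a haC ha using fun i => Finset.exists_min_image C (fun j => (Z j).1 i) ⟨j₀, hj₀⟩
  let m : I → ℕ := fun i => (Z (a i)).1 i
  have hM : M < ∑ i ∈ C, (m i + 1) := by
    by_contra! hcon
    -- If `M` were large enough, this lattice point would exceed every minimum `m i` with `i ∈ C`,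
    -- against dominance; the remaining mass is put at `j₀`.
    obtain ⟨i, hi, hiy⟩ := hdomT (fun i => (if i ∈ C then m i + 1 else 0) +
      if i = j₀ then M - ∑ i ∈ C, (m i + 1) else 0) (by
        rw [Finset.sum_add_distrib, Finset.sum_ite_mem, Finset.univ_inter]
        simp only [Finset.sum_ite_eq', Finset.mem_univ, if_true]
        omega)
    have := hiy (a i) (haC i)
    simp only [if_pos hi, m] at this
    omega
  rw [Finset.sum_add_distrib, Finset.sum_const, smul_eq_mul, mul_one] at hM
  have hCcard : C.card ≤ Fintype.card I := Finset.card_le_univ C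
  -- By `hM` the sum of `w` is larger than `M - C.card`. So each `Z j` with `j ∈ C` lies above `w`
  -- with total excess less than `C.card`, and these points are close to one another.
  let w : I → ℕ := fun k => if k ∈ C then m k else 0
  have hw : ∀ j ∈ C, ∀ k, w k ≤ (Z j).1 k ∧ (Z j).1 k ≤ w k + Fintype.card I := by
    intro j hj k
    have hmle : ∀ i, m i ≤ (Z j).1 i := fun i => ha i j hj
    have hsum := hTsum (Z j)
    by_cases hk : k ∈ C
    · simp only [w, if_pos hk]
      refine ⟨hmle k, ?_⟩
      have h1 : ∑ i ∈ C, (Z j).1 i ≤ M :=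
        (Finset.sum_le_sum_of_subset (Finset.subset_univ _)).trans_eq hsum
      rw [← Finset.add_sum_erase _ _ hk] at h1 hM
      have h2 : ∑ i ∈ C.erase k, m i ≤ ∑ i ∈ C.erase k, (Z j).1 i :=
        Finset.sum_le_sum fun i _ => hmle i
      omega
    · simp only [w, if_neg hk]
      refine ⟨Nat.zero_le _, ?_⟩
      have h1 : (Z j).1 k + ∑ i ∈ C, (Z j).1 i ≤ M := by
        rw [← Finset.sum_insert (f := (Z j).1) hk]
        exact (Finset.sum_le_sum_of_subset (Finset.subset_univ _)).trans_eq hsum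
      have h2 : ∑ i ∈ C, m i ≤ ∑ i ∈ C, (Z j).1 i := Finset.sum_le_sum fun i _ => hmle i
      omega
  refine ⟨(Z j₀).1, hTsum _, fun i => ?_⟩
  by_cases hi : i ∈ C
  · refine Or.inr ⟨(Z i).1, hTsum _, ?_, fun k => ?_⟩
    · have := hce i
      rwa [hZ i hi] at this
    · have h1 := hw j₀ hj₀ k
      have h2 := hw i hi k
      omega
  · have := (hw j₀ hj₀ i).2
    simp only [w, if_neg hi, zero_add] at this
    exact Or.inl this

/-! ### A covering theorem of KKM type. -/

/-- If the standard simplex is covered by closed sets `G i`, one for each vertex, then some point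
of the simplex lies in all the `G i` for which its `i`-th coordinate does not vanish. -/
theorem exists_mem_stdSimplex_of_closed_cover {I : Type*} [Fintype I] [Nonempty I]
    (G : I → Set (I → ℝ)) (hG : ∀ i, IsClosed (G i))
    (hcov : ∀ p ∈ stdSimplex ℝ I, ∃ i, p ∈ G i) :
    ∃ p ∈ stdSimplex ℝ I, ∀ i, p i ≠ 0 → p ∈ G i := by
  classical
  -- `A ε` is the approximate version of the claim: it is compact, increases with `ε`, and contains
  -- a rescaled lattice point once the mesh is fine enough. A point common to all `A ε` is the limit
  -- sought.
  let A : Set.Ioi (0 : ℝ) → Set (I → ℝ) := fun ε =>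
    stdSimplex ℝ I ∩ ⋂ i, ({p | p i ≤ ε} ∪ Metric.cthickening ε (G i))
  have hAclosed : ∀ ε, IsClosed (A ε) := fun ε =>
    (isClosed_stdSimplex ℝ I).inter (isClosed_iInter fun i =>
      (isClosed_le (continuous_apply i) continuous_const).union Metric.isClosed_cthickening)
  have hmono : ∀ ε δ : Set.Ioi (0 : ℝ), ε ≤ δ → A ε ⊆ A δ := by
    intro ε δ h p hp
    refine ⟨hp.1, Set.mem_iInter.2 fun i => ?_⟩
    rcases Set.mem_iInter.1 hp.2 i with h' | h'
    · exact Or.inl (le_trans (b := (ε : ℝ)) h' h)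
    · exact Or.inr (Metric.cthickening_mono h _ h')
  have hne : ∀ ε, (A ε).Nonempty := by
    rintro ⟨ε, hε : 0 < ε⟩
    obtain ⟨M, hM⟩ := exists_nat_gt ((Fintype.card I : ℝ) / ε)
    have hM0 : (0 : ℝ) < M := lt_of_le_of_lt (by positivity) hM
    have hMε : (Fintype.card I : ℝ) / M ≤ ε := by
      rw [div_lt_iff₀ hε] at hM
      rw [div_le_iff₀ hM0]
      linarith
    have hsimplex : ∀ x : I → ℕ, ∑ k, x k = M → (fun k => (x k : ℝ) / M) ∈ stdSimplex ℝ I := by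
      intro x hx
      refine ⟨fun k => by positivity, ?_⟩
      rw [← Finset.sum_div, ← Nat.cast_sum, hx, div_self hM0.ne']
    have hcov' : ∀ x : I → ℕ, ∃ i, ∑ k, x k = M → (fun k => (x k : ℝ) / M) ∈ G i := by
      intro x
      by_cases hx : ∑ k, x k = M
      · obtain ⟨i, hi⟩ := hcov _ (hsimplex x hx)
        exact ⟨i, fun _ => hi⟩
      · exact ⟨Classical.arbitrary I, fun h => absurd h hx⟩
    choose c hc using hcov'
    obtain ⟨p, hp, hpi⟩ := exists_lattice_point_near_colors M c
    refine ⟨_, hsimplex p hp, Set.mem_iInter.2 fun i => ?_⟩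
    rcases hpi i with h | ⟨x, hx, rfl, hpx⟩
    · left
      refine le_trans ?_ hMε
      have : (p i : ℝ) ≤ Fintype.card I := by exact_mod_cast h
      exact div_le_div_of_nonneg_right this hM0.le
    · right
      refine Metric.mem_cthickening_of_dist_le _ _ _ _ (hc x hx) ?_
      refine (dist_pi_le_iff hε.le).2 fun k => ?_
      refine le_trans ?_ hMε
      have h1 : (p k : ℝ) ≤ x k + Fintype.card I := by exact_mod_cast (hpx k).1
      have h2 : (x k : ℝ) ≤ p k + Fintype.card I := by exact_mod_cast (hpx k).2
      rw [Real.dist_eq, ← sub_div, abs_div, abs_of_pos hM0]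
      refine div_le_div_of_nonneg_right ?_ hM0.le
      rw [abs_le]
      constructor <;> linarith
  have : Nonempty (Set.Ioi (0 : ℝ)) := ⟨⟨1, Set.mem_Ioi.2 one_pos⟩⟩
  obtain ⟨p, hp⟩ := IsCompact.nonempty_iInter_of_directed_nonempty_isCompact_isClosed A
    (fun ε δ => ⟨min ε δ, hmono _ _ (min_le_left _ _), hmono _ _ (min_le_right _ _)⟩) hne
    (fun ε => (isCompact_stdSimplex ℝ I).inter_right ((isClosed_iInter fun i =>
      (isClosed_le (continuous_apply i) continuous_const).union Metric.isClosed_cthickening)))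
    hAclosed
  rw [Set.mem_iInter] at hp
  have hps := (hp ⟨1, Set.mem_Ioi.2 one_pos⟩).1
  refine ⟨p, hps, fun i hi => ?_⟩
  have hpos : 0 < p i := lt_of_le_of_ne (hps.1 i) hi.symm
  -- For `ε < p i` the alternative `p i ≤ ε` is ruled out, and these `ε` suffice to recover the
  -- closure of `G i`.
  rw [← (hG i).closure_eq, Metric.closure_eq_iInter_cthickening' (G i) (Set.Ioo 0 (p i))]
  · simp only [Set.mem_iInter]
    intro ε hε
    rcases Set.mem_iInter.1 (hp ⟨ε, hε.1⟩).2 i with h | h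
    · exact absurd h (not_le.2 hε.2)
    · exact h
  · intro ε hε
    obtain ⟨δ, h1, h2⟩ := exists_between (lt_min hε hpos)
    exact ⟨δ, ⟨h1, h2.trans_le (min_le_right _ _)⟩, h1, (h2.trans_le (min_le_left _ _)).le⟩

/-! ### Equilibria of two-player games with quasi-convex costs. -/

section QuasiconvexGame

variable {E F : Type*} [AddCommGroup E] [Module ℝ E] [TopologicalSpace E]
  [IsTopologicalAddGroup E] [ContinuousSMul ℝ E] [AddCommGroup F] [Module ℝ F]
  [TopologicalSpace F] [IsTopologicalAddGroup F] [ContinuousSMul ℝ F]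

/-- Terms of weight zero drop out, so only the support matters, and the covering theorem controls
just the indices in the support. -/
theorem Convex.sum_mem_of_ne_zero {E ι : Type*} [AddCommGroup E] [Module ℝ E] [Fintype ι]
    {s : Set E} (hs : Convex ℝ s) {p : ι → ℝ} (hp : p ∈ stdSimplex ℝ ι) {z : ι → E}
    (hz : ∀ i, p i ≠ 0 → z i ∈ s) : ∑ i, p i • z i ∈ s := by
  classical
  have h1 : ∑ i ∈ Finset.univ.filter (fun i => p i ≠ 0), p i • z i = ∑ i, p i • z i :=
    Finset.sum_filter_of_ne fun i _ h hi => h (by rw [hi, zero_smul])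
  rw [← h1]
  refine hs.sum_mem (fun i _ => hp.1 i) ?_ fun i hi => hz i (Finset.mem_filter.1 hi).2
  rw [Finset.sum_filter_ne_zero]
  exact hp.2

/-- In a two-player game with continuous, quasi-convex costs on convex strategy sets, some strategy
profile resists all deviations in given finite sets. -/
theorem exists_profile_of_finite_deviations {K : Set E} {L : Set F}
    (hK : Convex ℝ K) (hL : Convex ℝ L) {f g : E → F → ℝ}
    (hf : ContinuousOn (fun z : E × F => f z.1 z.2) (K ×ˢ L))
    (hg : ContinuousOn (fun z : E × F => g z.1 z.2) (K ×ˢ L))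
    (hfq : ∀ y ∈ L, QuasiconvexOn ℝ K fun x => f x y)
    (hgq : ∀ x ∈ K, QuasiconvexOn ℝ L fun y => g x y)
    (A : Finset E) (B : Finset F) (hA : A.Nonempty) (hB : B.Nonempty)
    (hAK : ∀ a ∈ A, a ∈ K) (hBL : ∀ b ∈ B, b ∈ L) :
    ∃ x ∈ K, ∃ y ∈ L, (∀ a ∈ A, f x y ≤ f a y) ∧ ∀ b ∈ B, g x y ≤ g x b := by
  let I := A × B
  have : Nonempty I := ⟨⟨hA.choose, hA.choose_spec⟩, ⟨hB.choose, hB.choose_spec⟩⟩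
  let X : (I → ℝ) → E := fun p => ∑ i, p i • (i.1 : E)
  let Y : (I → ℝ) → F := fun p => ∑ i, p i • (i.2 : F)
  have hXc : Continuous X := by fun_prop
  have hYc : Continuous Y := by fun_prop
  have hX : ∀ p ∈ stdSimplex ℝ I, X p ∈ K := fun p hp =>
    hK.sum_mem_of_ne_zero hp fun i _ => hAK _ i.1.2
  have hY : ∀ p ∈ stdSimplex ℝ I, Y p ∈ L := fun p hp =>
    hL.sum_mem_of_ne_zero hp fun i _ => hBL _ i.2.2
  have hfc : ∀ a ∈ A, ContinuousOn (fun p => f a (Y p)) (stdSimplex ℝ I) := fun a ha =>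
    hf.comp (f := fun p => (a, Y p)) (by fun_prop) fun p hp => ⟨hAK a ha, hY p hp⟩
  have hgc : ∀ b ∈ B, ContinuousOn (fun p => g (X p) b) (stdSimplex ℝ I) := fun b hb =>
    hg.comp (f := fun p => (X p, b)) (by fun_prop) fun p hp => ⟨hX p hp, hBL b hb⟩
  let G : I → Set (I → ℝ) := fun i =>
    (⋂ a : A, {p ∈ stdSimplex ℝ I | f i.1 (Y p) ≤ f a (Y p)}) ∩
      ⋂ b : B, {p ∈ stdSimplex ℝ I | g (X p) i.2 ≤ g (X p) b}
  have hG : ∀ i, IsClosed (G i) := fun i =>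
    (isClosed_iInter fun a => (isClosed_stdSimplex ℝ I).isClosed_le
      (hfc _ i.1.2) (hfc _ a.2)).inter
    (isClosed_iInter fun b => (isClosed_stdSimplex ℝ I).isClosed_le (hgc _ i.2.2) (hgc _ b.2))
  obtain ⟨p, hp, hpG⟩ := exists_mem_stdSimplex_of_closed_cover G hG fun p hp => by
    obtain ⟨a, ha, hamin⟩ := A.exists_min_image (fun a => f a (Y p)) hA
    obtain ⟨b, hb, hbmin⟩ := B.exists_min_image (fun b => g (X p) b) hB
    exact ⟨(⟨a, ha⟩, ⟨b, hb⟩), Set.mem_iInter.2 fun a' => ⟨hp, hamin _ a'.2⟩,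
      Set.mem_iInter.2 fun b' => ⟨hp, hbmin _ b'.2⟩⟩
  refine ⟨X p, hX p hp, Y p, hY p hp, fun a ha => ?_, fun b hb => ?_⟩
  -- The convex set is the sublevel set of `f · (Y p)` at height `f a (Y p)`.
  · exact ((hfq (Y p) (hY p hp) (f a (Y p))).sum_mem_of_ne_zero hp (z := fun i => (i.1 : E))
      fun i hi => ⟨hAK _ i.1.2, (Set.mem_iInter.1 (hpG i hi).1 ⟨a, ha⟩).2⟩).2
  · exact ((hgq (X p) (hX p hp) (g (X p) b)).sum_mem_of_ne_zero hp (z := fun i => (i.2 : F))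
      fun i hi => ⟨hBL _ i.2.2, (Set.mem_iInter.1 (hpG i hi).2 ⟨b, hb⟩).2⟩).2

/-- **Nash's theorem** for two players with quasi-convex costs. -/
theorem exists_nash_of_quasiconvexOn [T2Space E] [T2Space F] {K : Set E} {L : Set F}
    (hKne : K.Nonempty) (hLne : L.Nonempty) (hKc : IsCompact K) (hLc : IsCompact L)
    (hK : Convex ℝ K) (hL : Convex ℝ L) {f g : E → F → ℝ}
    (hf : ContinuousOn (fun z : E × F => f z.1 z.2) (K ×ˢ L))
    (hg : ContinuousOn (fun z : E × F => g z.1 z.2) (K ×ˢ L))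
    (hfq : ∀ y ∈ L, QuasiconvexOn ℝ K fun x => f x y)
    (hgq : ∀ x ∈ K, QuasiconvexOn ℝ L fun y => g x y) :
    ∃ x ∈ K, ∃ y ∈ L, (∀ a ∈ K, f x y ≤ f a y) ∧ ∀ b ∈ L, g x y ≤ g x b := by
  classical
  obtain ⟨a₀, ha₀⟩ := hKne
  obtain ⟨b₀, hb₀⟩ := hLne
  have hcl : IsClosed (K ×ˢ L) := hKc.isClosed.prod hLc.isClosed
  let N : K × L → Set (E × F) := fun v =>
    {z ∈ K ×ˢ L | f z.1 z.2 ≤ f v.1 z.2} ∩ {z ∈ K ×ˢ L | g z.1 z.2 ≤ g z.1 v.2}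
  have hN : ∀ v, IsClosed (N v) := fun v =>
    (hcl.isClosed_le hf (hf.comp (f := fun z : E × F => ((v.1 : E), z.2)) (by fun_prop)
      fun z hz => ⟨v.1.2, hz.2⟩)).inter
    (hcl.isClosed_le hg (hg.comp (f := fun z : E × F => (z.1, (v.2 : F))) (by fun_prop)
      fun z hz => ⟨hz.1, v.2.2⟩))
  obtain ⟨⟨x, y⟩, ⟨hx, hy⟩, hxy⟩ := (hKc.prod hLc).inter_iInter_nonempty N hN fun u => by
    obtain ⟨x, hx, y, hy, h1, h2⟩ := exists_profile_of_finite_deviations hK hL hf hg hfq hgq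
      -- Inserting `a₀` and `b₀` keeps the deviation sets nonempty when `u` is empty.
      (insert a₀ (u.image fun v => (v.1 : E))) (insert b₀ (u.image fun v => (v.2 : F)))
      (Finset.insert_nonempty _ _) (Finset.insert_nonempty _ _)
      (fun a ha => by
        rcases Finset.mem_insert.1 ha with rfl | ha
        · exact ha₀
        · obtain ⟨v, -, rfl⟩ := Finset.mem_image.1 ha
          exact v.1.2)
      (fun b hb => by
        rcases Finset.mem_insert.1 hb with rfl | hb
        · exact hb₀
        · obtain ⟨v, -, rfl⟩ := Finset.mem_image.1 hb
          exact v.2.2)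
    refine ⟨(x, y), ⟨hx, hy⟩, Set.mem_iInter₂.2 fun v hv => ⟨⟨⟨hx, hy⟩, ?_⟩, ⟨⟨hx, hy⟩, ?_⟩⟩⟩
    · exact h1 _ (Finset.mem_insert_of_mem (Finset.mem_image_of_mem (fun v => (v.1 : E)) hv))
    · exact h2 _ (Finset.mem_insert_of_mem (Finset.mem_image_of_mem (fun v => (v.2 : F)) hv))
  rw [Set.mem_iInter] at hxy
  exact ⟨x, hx, y, hy, fun a ha => (hxy (⟨a, ha⟩, ⟨b₀, hb₀⟩)).1.2,
    fun b hb => (hxy (⟨a₀, ha₀⟩, ⟨b, hb⟩)).2.2⟩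

end QuasiconvexGame

theorem theorem1 {m n sl sd : ℕ} (G : RandomizedPredictionGame m n sl sd)
    (hcl : ContinuousOn (fun θ : EuclideanSpace ℝ (Fin sl) × EuclideanSpace ℝ (Fin sd) =>
      G.expCostl θ.1 θ.2) (G.Θl ×ˢ G.Θd))
    (hcd : ContinuousOn (fun θ : EuclideanSpace ℝ (Fin sl) × EuclideanSpace ℝ (Fin sd) =>
      G.expCostd θ.1 θ.2) (G.Θl ×ˢ G.Θd))
    (hql : ∀ θd ∈ G.Θd, QuasiconvexOn ℝ G.Θl (fun θl => G.expCostl θl θd))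
    (hqd : ∀ θl ∈ G.Θl, QuasiconvexOn ℝ G.Θd (fun θd => G.expCostd θl θd)) :
    ∃ θl θd, G.IsNashEquilibrium θl θd := by
  obtain ⟨θl, hl, θd, hd, h1, h2⟩ := exists_nash_of_quasiconvexOn G.Θl_nonempty G.Θd_nonempty
    G.Θl_compact G.Θd_compact G.Θl_convex G.Θd_convex hcl hcd hql hqd
  exact ⟨θl, θd, hl, hd, h1, h2⟩
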